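/- Notation. A permutation of length $n$ is written in one-line notation $\pi=\pi_1\pi_2\ldots\pi_n$, a word using each of the letters $1,\ldots,n$ exactly once. All permutations form a poset in which $\sigma\le\pi$ if $\sigma$ occurs as a pattern in $\pi$, i.e. if $\pi$ has a subsequence whose letters are in the same relative order of size as those of $\sigma$. Let $\mu$ be the Möbius function of this poset ($\mu(\sigma,\sigma)=1$, $\mu(\sigma,\lambda)=-\sum_{\sigma\le z<\lambda}\mu(\sigma,z)$ for $\sigma<\lambda$, and $\mu(\sigma,\lambda)=0$ if $\sigma\not\le\lambda$), and write $\mu(\pi)=\mu(1,\pi)$, where $1$ is the permutation of length one. A descent of $\pi$ at position $i$ ($1\le i<n$) means $\pi_i>\pi_{i+1}$; an adjacency at position $i$ ($1\le i<n$) means $\pi_{i+1}=\pi_i+1$, and its value is $\pi_i$. A triple adjacency consists of adjacencies at two consecutive positions $i,i+1$ (and counts as two adjacencies). For $m>1$ put $W_m=1\,3\,5\ldots(2m-1)\,2\,4\,6\ldots(2m)$ and $M_m=2\,4\,6\ldots(2m)\,1\,3\,5\ldots(2m-1)$. **Theorem.** Let $\pi$ be a permutation of length $n>2$ with at most one descent.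 Then: 1. If $\pi$ begins with $12$ or ends in $(n-1)n$, then $\mu(\pi)=0$. 2. If $\pi$ has a triple adjacency, then $\mu(\pi)=0$. 3. If $\pi$ has more than two adjacencies, then $\mu(\pi)=0$. 4. If $\pi$ has exactly two adjacencies, then (a) if the first (leftmost) adjacency has greater value than the second, then $\mu(\pi)=\pm1$; (b) if the first adjacency has lower value than the second, then $\mu(\pi)=0$. 5. If $\pi$ has exactly one adjacency, at position $i$, and the descent is at position $d$, then (a) if $i<d$ and $\pi_1\ne1$, then $\mu(\pi)=\pm i$; (b) if $i<d$ and $\pi_1=1$, then $\mu(\pi)=\pm(i-1)$; (c) if $i>d$ and $\pi_n\ne n$, then $\mu(\pi)=\pm(n-i)$; (d) if $i>d$ and $\pi_n=n$, then $\mu(\pi)=\pm(n-i-1)$. 6. If $\pi$ has no adjacencies, then (a) if $n$ is even, then $\pi_1\in\{1,2\}$; if moreover $\pi_1=1$, then $\pi=W_{n/2}$ and $\mu(\pi)=-\binom{n/2}{2}$; (b) if $n$ is even and $\pi_1=2$, then $\pi=M_{n/2}$ and $\mu(\pi)=-\binom{n/2+1}{2}$; (c) if $n$ is odd, then $\mu(\pi)=\binom{(n+1)/2}{2}$.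 7. If $\mu(\pi)\ne0$, then $\mu(\pi)$ is positive if and only if $n$ is odd; this determines the signs in 4 and 5. -/

import Mathlib

/-- A permutation of `{1, …, n}` for some `n`, carrying its length `n`. Positions and letters are
stored from `0` on; `FinPerm.letter` below gives the usual one-line notation `π₁π₂…πₙ`.
The empty permutation is allowed; it lies in no interval `[1, π]`. -/
@[ext]
structure FinPerm where
  length : ℕ
  perm : Equiv.Perm (Fin length)
  deriving DecidableEq

namespace FinPerm

/-- Pattern containment: `σ ≤ π` iff some subsequence of `π`, at the positions
`f 0 < f 1 < …`, has its letters in the same relative order as those of `σ`. -/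
instance : LE FinPerm where
  le σ π := ∃ f : Fin σ.length → Fin π.length, StrictMono f ∧
    ∀ i j, σ.perm i < σ.perm j ↔ π.perm (f i) < π.perm (f j)

theorem le_def (σ π : FinPerm) : σ ≤ π ↔ ∃ f : Fin σ.length → Fin π.length, StrictMono f ∧
    ∀ i j, σ.perm i < σ.perm j ↔ π.perm (f i) < π.perm (f j) := Iff.rfl

theorem length_le_of_le {σ π : FinPerm} (h : σ ≤ π) : σ.length ≤ π.length := by
  obtain ⟨f, hf, -⟩ := h
  simpa using Fintype.card_le_of_injective f hf.injective

theorem eq_id_of_strictMono {n : ℕ} {f : Fin n → Fin n} (hf : StrictMono f) : f = id := by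
  have hs := Finite.surjective_of_injective hf.injective
  have := Subsingleton.elim (hf.orderIsoOfSurjective f hs) (OrderIso.refl (Fin n))
  ext1 i
  exact DFunLike.congr_fun this i

instance : PartialOrder FinPerm where
  le_refl _ := ⟨id, strictMono_id, fun _ _ => Iff.rfl⟩
  le_trans _ _ _ := by
    rintro ⟨f, hf, hf'⟩ ⟨g, hg, hg'⟩
    exact ⟨g ∘ f, hg.comp hf, fun i j => (hf' i j).trans (hg' _ _)⟩
  le_antisymm σ π := by
    intro h h'
    have hl := le_antisymm (length_le_of_le h) (length_le_of_le h')
    obtain ⟨f, hf, hf'⟩ := h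
    obtain ⟨n, σ⟩ := σ
    obtain ⟨m, π⟩ := π
    dsimp only at hl f hf hf'
    subst hl
    obtain rfl := eq_id_of_strictMono hf
    have hm : StrictMono (fun i => π (σ.symm i)) := fun i j hij => by
      have := hf' (σ.symm i) (σ.symm j)
      simp only [Equiv.apply_symm_apply, id] at this
      exact this.1 hij
    have he := eq_id_of_strictMono hm
    congr 1
    ext1 i
    simpa using (congrFun he (σ i)).symm

theorem finite_Icc (σ π : FinPerm) : (Set.Icc σ π).Finite := by
  refine Set.Finite.subset (((Finset.range (π.length + 1)).sigma
    fun n => (Finset.univ : Finset (Equiv.Perm (Fin n)))).finite_toSet.image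
      fun x => (⟨x.1, x.2⟩ : FinPerm)) ?_
  rintro ⟨n, τ⟩ ⟨-, h⟩
  have hn := length_le_of_le h
  exact ⟨⟨n, τ⟩, by simpa [Nat.lt_succ_iff] using hn, rfl⟩

noncomputable instance : LocallyFiniteOrder FinPerm := LocallyFiniteOrder.ofFiniteIcc finite_Icc

/-- The permutation `1` of length one. -/
def one : FinPerm := ⟨1, 1⟩

/-- The Möbius value `μ(π) = μ(1, π)` in the poset of permutations. -/
noncomputable def mobius (π : FinPerm) : ℤ := IncidenceAlgebra.mu ℤ one π

/-- The letter `πᵢ` in the one-line notation `π₁π₂…πₙ`, for `1 ≤ i ≤ n` (and `0` otherwise). -/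
def letter (π : FinPerm) (i : ℕ) : ℕ :=
  if h : 1 ≤ i ∧ i ≤ π.length then (π.perm ⟨i - 1, by omega⟩ : ℕ) + 1 else 0

/-- The positions of the descents: `1 ≤ i < n` with `πᵢ > πᵢ₊₁`. -/
def descents (π : FinPerm) : Finset ℕ :=
  (Finset.Ico 1 π.length).filter fun i => π.letter (i + 1) < π.letter i

/-- The positions of the adjacencies: `1 ≤ i < n` with `πᵢ₊₁ = πᵢ + 1`. -/
def adjacencies (π : FinPerm) : Finset ℕ :=
  (Finset.Ico 1 π.length).filter fun i => π.letter (i + 1) = π.letter i + 1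

/-- `M m = 2 4 6 … (2m) 1 3 5 … (2m-1)`. -/
def M (m : ℕ) : FinPerm where
  length := 2 * m
  perm :=
    { toFun := fun i => ⟨if i.1 < m then 2 * i.1 + 1 else 2 * (i.1 - m), by split <;> omega⟩
      invFun := fun j => ⟨if j.1 % 2 = 1 then j.1 / 2 else m + j.1 / 2, by split <;> omega⟩
      left_inv := fun i => by ext; dsimp only; split_ifs <;> omega
      right_inv := fun j => by ext; dsimp only; split_ifs <;> omega }

/-- `W m = 1 3 5 … (2m-1) 2 4 6 … (2m)`. -/
def W (m : ℕ) : FinPerm where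
  length := 2 * m
  perm :=
    { toFun := fun i => ⟨if i.1 < m then 2 * i.1 else 2 * (i.1 - m) + 1, by split <;> omega⟩
      invFun := fun j => ⟨if j.1 % 2 = 0 then j.1 / 2 else m + j.1 / 2, by split <;> omega⟩
      left_inv := fun i => by ext; dsimp only; split_ifs <;> omega
      right_inv := fun j => by ext; dsimp only; split_ifs <;> omega }

end FinPerm

/-! Recording, for the letters 1, …, n in turn, whether each stands right of the descent encodes a
permutation with at most one descent as a binary word. Pattern containment then becomes subword
order, and the encoding is faithful except that every word false…false true…true yields an
increasing permutation (`ofWord_injOn`).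

In subword order, Björner's formula gives μ(x, w) up to sign as the number of normal embeddings of x
in w, those using every letter equal to its predecessor; `sum_normalSum` is its summed form. For x =
[true, false], the word of 21, it gives a function that vanishes on increasing permutations and sums
over [1, π] to 1 if π = 21 and to 0 otherwise. The function [z = 1] - [z = 12] sums over [1, π] to 1
- [12 ≤ π], and among the π of length at least 2 only 21 avoids 12. Hence the difference of the two
functions satisfies the recursion that defines μ (`mobius_ofWord_eq`).

Equal neighbours in the word are adjacencies and occurrences of true, false are inversions. So for n
> 2, μ(π) is (-1)^(n+1) times the number of inversions that contain the second position of every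
adjacency (`mobius_eq`). Two adjacencies leave at most one such inversion and more leave none; one
adjacency fixes an end of the inversion; with no adjacency all inversions count. In the last two
cases the missing adjacencies force letters to rise in steps of 2, and a position a left of the
descent begins π_a - a inversions. -/

/-- The distinct subwords of a word. -/
def subwords {α : Type*} [DecidableEq α] (w : List α) : Finset (List α) := w.sublists.toFinset

/-- The number of embeddings of `x` in `u` that use every letter equal to its predecessor, counted
with the sign `(-1) ^ |u|`; the predecessor of the first letter is `p`. -/
def normalSum {α : Type*} [DecidableEq α] : Option α → List α → List α → ℤ
  | _, [], x => if x = [] then 1 else 0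
  | p, b :: u, x => -((if x.head? = some b then normalSum (some b) u x.tail else 0) +
      (if p = some b then 0 else normalSum (some b) u x))

/-- The sum of `g` over the distinct subwords of a word that begin with `a`. -/
def headSum {α : Type*} [DecidableEq α] (a : α) (g : List α → ℤ) : List α → ℤ
  | [] => 0
  | b :: w => if a = b then ∑ u ∈ subwords w, g (a :: u) else headSum a g w

/-- The signed number of the suffixes equal to `x` that are preceded by the letter `a`. -/
def suffixSum {α : Type*} [DecidableEq α] (a : α) (x : List α) : List α → ℤ
  | [] => 0
  | b :: w => (if a = b then (if w = x then (-1) ^ x.length else 0) else 0) + suffixSum a x w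

/-! ### Möbius function of subword order -/

section Subwords

variable {α : Type*} [DecidableEq α]

theorem mem_subwords {u w : List α} : u ∈ subwords w ↔ u.Sublist w := by
  simp [subwords]

/-- A subword beginning with `a` can always be embedded with its first letter at the first `a` of
the word. -/
theorem headSum_eq (a : α) (g : List α → ℤ) (w : List α) :
    headSum a g w = ∑ u ∈ (subwords w).filter (fun u => u.head? = some a), g u := by
  induction w with
  | nil => simp [headSum, subwords, Finset.filter_singleton]
  | cons b w ih =>
    rw [headSum]
    split_ifs with h
    · subst h
      rw [← Finset.sum_image (s := subwords w) (g := fun u => a :: u) (f := g)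
        (by intro x _ y _ h; simpa using h)]
      congr 1
      ext u
      cases u with
      | nil => simp
      | cons c u =>
        simp only [Finset.mem_image, Finset.mem_filter, mem_subwords, List.cons.injEq,
          List.head?_cons, Option.some.injEq]
        constructor
        · rintro ⟨v, hv, rfl, rfl⟩
          exact ⟨hv.cons_cons _, rfl⟩
        · rintro ⟨hv, rfl⟩
          exact ⟨u, List.cons_sublist_cons.1 hv, rfl, rfl⟩
    · rw [ih]
      congr 1
      ext u
      cases u with
      | nil => simp
      | cons c u =>
        simp only [Finset.mem_filter, mem_subwords, List.head?_cons, Option.some.injEq]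
        constructor
        · rintro ⟨hv, rfl⟩
          exact ⟨hv.cons _, rfl⟩
        · rintro ⟨hv, rfl⟩
          refine ⟨?_, rfl⟩
          cases hv with
          | cons _ h' => exact h'
          | cons_cons _ _ => exact absurd rfl h

/-- Subwords are counted without multiplicity: those counted twice begin with `a` and already occur
in `w`, and `headSum` removes them once. -/
theorem sum_subwords_cons (g : List α → ℤ) (a : α) (w : List α) :
    ∑ u ∈ subwords (a :: w), g u =
      ∑ u ∈ subwords w, g u + ∑ u ∈ subwords w, g (a :: u) - headSum a g w := by
  have h1 : ∑ u ∈ subwords w, g (a :: u) = headSum a g (a :: w) := by simp [headSum]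
  rw [h1, headSum_eq, headSum_eq,
    ← Finset.sum_filter_add_sum_filter_not (subwords (a :: w)) (fun u => u.head? = some a),
    ← Finset.sum_filter_add_sum_filter_not (subwords w) (fun u => u.head? = some a)]
  have h2 : (subwords (a :: w)).filter (fun u => ¬ u.head? = some a) =
      (subwords w).filter (fun u => ¬ u.head? = some a) := by
    ext u
    simp only [Finset.mem_filter, mem_subwords]
    refine and_congr_left fun h => ⟨fun hu => ?_, fun hu => hu.cons _⟩
    cases hu with
    | cons _ h' => exact h'
    | cons_cons _ _ => simp at h
  rw [h2]
  ring

theorem sum_subwords_eq_add_headSum (a : α) (g h : List α → ℤ)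
    (hgh : ∀ u : List α, u.head? ≠ some a → g u = h u) (w : List α) :
    ∑ u ∈ subwords w, g u = ∑ u ∈ subwords w, h u - headSum a h w + headSum a g w := by
  rw [headSum_eq, headSum_eq,
    ← Finset.sum_filter_add_sum_filter_not (subwords w) (fun u => u.head? = some a) g,
    ← Finset.sum_filter_add_sum_filter_not (subwords w) (fun u => u.head? = some a) h,
    Finset.sum_congr rfl (fun u hu => hgh u (Finset.mem_filter.1 hu).2)]
  ring

theorem normalSum_some_eq_none {a : α} {u x : List α} (h : u.head? ≠ some a) :
    normalSum (some a) u x = normalSum none u x := by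
  cases u with
  | nil => rfl
  | cons b u =>
    have : a ≠ b := fun h' => h (by simp [h'])
    simp [normalSum, this]

/-- Björner's formula alone does not carry an induction: a new first letter brings in sums with a
remembered predecessor and sums restricted to subwords beginning with a given letter. The four
identities together are stable under adding a letter in front, and the suffix counts cancel in the
first. -/
theorem sum_normalSum_aux (w : List α) : ∀ x : List α,
    (∑ u ∈ subwords w, normalSum none u x = if w = x then (-1) ^ x.length else 0) ∧
    ∀ a : α,
      (headSum a (fun u => normalSum none u x) w =
        -(suffixSum a x w + if x.head? = some a then suffixSum a x.tail w else 0)) ∧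
      (headSum a (fun u => normalSum (some a) u x) w =
        -(if x.head? = some a then suffixSum a x.tail w else 0)) ∧
      (∑ u ∈ subwords w, normalSum (some a) u x =
        (if w = x then (-1) ^ x.length else 0) + suffixSum a x w) := by
  induction w with
  | nil =>
    intro x
    cases x <;> simp [subwords, normalSum, headSum, suffixSum]
  | cons b w ih =>
    intro x
    have key : ∀ p : Option α, ∑ u ∈ subwords w, normalSum p (b :: u) x =
        -((if x.head? = some b then ∑ u ∈ subwords w, normalSum (some b) u x.tail else 0) +
          (if p = some b then 0 else ∑ u ∈ subwords w, normalSum (some b) u x)) := by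
      intro p
      simp only [normalSum, Finset.sum_neg_distrib, Finset.sum_add_distrib]
      split_ifs <;> simp
    have hF : ∑ u ∈ subwords (b :: w), normalSum none u x =
        if b :: w = x then (-1) ^ x.length else 0 := by
      rw [sum_subwords_cons, (ih x).1, key, ((ih x).2 b).1, ((ih x).2 b).2.2,
        ((ih x.tail).2 b).2.2]
      cases x with
      | nil => simp
      | cons c x =>
        by_cases hc : b = c
        · subst hc
          by_cases hw : w = x
          · simp [hw, pow_succ]; ring
          · simp [hw]; ring
        · have hc' : ¬ c = b := fun h => hc h.symm
          simp [hc, hc']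
    have hH : ∀ a : α,
      (headSum a (fun u => normalSum none u x) (b :: w) =
        -(suffixSum a x (b :: w) + if x.head? = some a then suffixSum a x.tail (b :: w) else 0)) ∧
      (headSum a (fun u => normalSum (some a) u x) (b :: w) =
        -(if x.head? = some a then suffixSum a x.tail (b :: w) else 0)) := by
      intro a
      by_cases hab : a = b
      · subst hab
        simp only [headSum, if_true, key, suffixSum, ((ih x).2 a).2.2, ((ih x.tail).2 a).2.2]
        constructor
        · simp; ring
        · simp
      · simp only [headSum, suffixSum, if_neg hab, ((ih x).2 a).1, ((ih x).2 a).2.1]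
        simp
    refine ⟨hF, fun a => ⟨(hH a).1, (hH a).2, ?_⟩⟩
    -- A remembered predecessor `a` matters only for subwords that begin with `a`.
    rw [sum_subwords_eq_add_headSum a _ _ (fun u hu => normalSum_some_eq_none hu), hF, (hH a).1,
      (hH a).2]
    ring

/-- Björner's formula for the Möbius function of subword order. -/
theorem sum_normalSum (w x : List α) :
    ∑ u ∈ subwords w, normalSum none u x = if w = x then (-1) ^ x.length else 0 :=
  (sum_normalSum_aux w x).1

end Subwords

theorem sublist_of_normalSum_ne_zero {α : Type*} [DecidableEq α] {u : List α} :
    ∀ {p : Option α} {x : List α}, normalSum p u x ≠ 0 → x.Sublist u := by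
  induction u with
  | nil =>
    intro p x h
    by_cases hx : x = []
    · simp [hx]
    · simp [normalSum, hx] at h
  | cons b u ih =>
    intro p x h
    by_contra hx
    apply h
    have h1 : ∀ q : Option α, normalSum q u x = 0 := fun q => by
      by_contra h'
      exact hx ((ih h').cons _)
    rw [normalSum, h1]
    cases x with
    | nil => simp at hx
    | cons c x =>
      by_cases hc : c = b
      · subst hc
        have h2 : normalSum (some c) u x = 0 := by
          by_contra h'
          exact hx ((ih h').cons_cons _)
        simp [h2]
      · simp [hc]

/-! ### Binary words and permutations with at most one descent -/

namespace FinPerm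

/-- The permutation whose one-line notation lists first the positions of the letters `false` of a
word and then those of the letters `true`, both in increasing order. -/
def ofWord (w : List Bool) : FinPerm := ⟨w.length, Tuple.sort w.get⟩

theorem ofWord_eq_mk {n : ℕ} (f : Fin n → Bool) (w : List Bool) (h : w.length = n)
    (hf : ∀ i, w.get i = f (Fin.cast h i)) : ofWord w = ⟨n, Tuple.sort f⟩ := by
  subst h
  have : w.get = f := funext hf
  rw [ofWord, this]

theorem symm_sort_lt {n : ℕ} (f : Fin n → Bool) {i j : Fin n}
    (h : f i < f j ∨ (f i = f j ∧ i < j)) :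
    (Tuple.sort f).symm i < (Tuple.sort f).symm j := by
  obtain ⟨h1, h2⟩ := Tuple.eq_sort_iff.1 (rfl : Tuple.sort f = Tuple.sort f)
  by_contra hc
  rw [not_lt] at hc
  have h3 : f j ≤ f i := by simpa using h1 hc
  rcases h with h | ⟨h, hij⟩
  · exact absurd h (not_lt.2 h3)
  · rcases hc.lt_or_eq with hc | hc
    · have := h2 _ _ hc (by simpa using h.symm)
      simp only [Equiv.apply_symm_apply] at this
      exact absurd this (not_lt.2 hij.le)
    · exact absurd ((Equiv.injective _ hc).symm) hij.ne

/-- A subword embedding preserves both the letters and the order of positions, hence the order used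
by stable sorting. -/
theorem ofWord_le_ofWord {u w : List Bool} (h : u.Sublist w) : ofWord u ≤ ofWord w := by
  obtain ⟨g, hg⟩ := List.sublist_iff_exists_fin_orderEmbedding_get_eq.1 h
  obtain ⟨h1, h2⟩ := Tuple.eq_sort_iff.1 (rfl : Tuple.sort u.get = Tuple.sort u.get)
  refine ⟨fun i => (Tuple.sort w.get).symm (g (Tuple.sort u.get i)), fun i j hij => ?_,
    fun i j => ?_⟩
  · apply symm_sort_lt
    rw [← hg, ← hg]
    rcases (h1 hij.le).lt_or_eq with h | h
    · exact Or.inl h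
    · exact Or.inr ⟨h, g.strictMono (h2 _ _ hij h)⟩
  · change Tuple.sort u.get i < Tuple.sort u.get j ↔
      Tuple.sort w.get ((Tuple.sort w.get).symm _) < Tuple.sort w.get ((Tuple.sort w.get).symm _)
    rw [Equiv.apply_symm_apply, Equiv.apply_symm_apply, g.lt_iff_lt]

/-- The letters of the copy of `σ`, in increasing order, are the positions of `w` at which the
subword is read. -/
theorem exists_sublist_of_le_ofWord {σ : FinPerm} {w : List Bool} (h : σ ≤ ofWord w) :
    ∃ u : List Bool, u.Sublist w ∧ ofWord u = σ := by
  obtain ⟨f, hf, hf'⟩ := h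
  obtain ⟨k, σ⟩ := σ
  dsimp only [ofWord] at f hf hf'
  obtain ⟨h1, h2⟩ := Tuple.eq_sort_iff.1 (rfl : Tuple.sort w.get = Tuple.sort w.get)
  have hg : StrictMono fun v => Tuple.sort w.get (f (σ.symm v)) := fun v v' hv => by
    refine (hf' _ _).1 ?_
    simpa using hv
  refine ⟨List.ofFn fun v => w.get (Tuple.sort w.get (f (σ.symm v))), ?_, ?_⟩
  · rw [List.sublist_iff_exists_fin_orderEmbedding_get_eq]
    refine ⟨OrderEmbedding.ofStrictMono (fun i => Tuple.sort w.get
      (f (σ.symm (Fin.cast (by simp) i)))) fun i j hij => hg (by simpa using hij), fun i => ?_⟩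
    simp only [List.get_ofFn]
    rfl
  · rw [ofWord_eq_mk (fun v => w.get (Tuple.sort w.get (f (σ.symm v)))) _ (by simp)
      fun i => List.get_ofFn _ i]
    congr 1
    symm
    rw [Tuple.eq_sort_iff]
    constructor
    · intro i j hij
      simpa using h1 (hf.monotone hij)
    · intro i j hij he
      rw [hf']
      exact h2 _ _ (hf hij) (by simpa using he)

/-- Where the sorted sequences differ, say at `k`, one is false up to `k` and the other true from
`k` on. Stability then makes the common sorting permutation increase up to `k` and from `k` on, so
it is the identity. -/
theorem eq_of_sort_eq {n : ℕ} {f g : Fin n → Bool} (h : Tuple.sort f = Tuple.sort g)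
    (hne : Tuple.sort f ≠ Equiv.refl _) : f = g := by
  have key : ∀ f g : Fin n → Bool, Tuple.sort f = Tuple.sort g → ∀ k : Fin n,
      f (Tuple.sort f k) = false → g (Tuple.sort f k) = true →
      Tuple.sort f = Equiv.refl _ := by
    intro f g h k hf hg
    obtain ⟨h1, h2⟩ := Tuple.eq_sort_iff.1 (rfl : Tuple.sort f = Tuple.sort f)
    obtain ⟨h3, h4⟩ := Tuple.eq_sort_iff.1 h
    have hfk : ∀ i ≤ k, f (Tuple.sort f i) = false := fun i hi => by
      have h5 : f (Tuple.sort f i) ≤ f (Tuple.sort f k) := h1 hi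
      rw [hf] at h5
      exact le_bot_iff.1 h5
    have hgk : ∀ i, k ≤ i → g (Tuple.sort f i) = true := fun i hi => by
      have h5 : g (Tuple.sort f k) ≤ g (Tuple.sort f i) := h3 hi
      rw [hg] at h5
      exact top_le_iff.1 h5
    have hlow : ∀ i j, i < j → j ≤ k → Tuple.sort f i < Tuple.sort f j := fun i j hij hj =>
      h2 _ _ hij (by rw [hfk i (hij.le.trans hj), hfk j hj])
    have hhigh : ∀ i j, i < j → k ≤ i → Tuple.sort f i < Tuple.sort f j := fun i j hij hi =>
      h4 _ _ hij (by rw [hgk i hi, hgk j (hi.trans hij.le)])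
    have hm : StrictMono (Tuple.sort f) := by
      intro i j hij
      rcases le_or_gt j k with hj | hj
      · exact hlow i j hij hj
      rcases le_or_gt k i with hi | hi
      · exact hhigh i j hij hi
      · exact (hlow i k hi le_rfl).trans (hhigh k j hj le_rfl)
    ext1 i
    exact congrFun (eq_id_of_strictMono hm) i
  by_contra hfg
  apply hne
  obtain ⟨k, hk⟩ : ∃ k, f (Tuple.sort f k) ≠ g (Tuple.sort f k) := by
    by_contra! hc
    exact hfg (funext fun v => by simpa using hc ((Tuple.sort f).symm v))
  cases hf : f (Tuple.sort f k) <;> cases hg : g (Tuple.sort f k)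
  · simp [hf, hg] at hk
  · exact key f g h k hf hg
  · rw [h]
    exact key g f h.symm k (by rw [← h]; exact hg) (by rw [← h]; exact hf)
  · simp [hf, hg] at hk

theorem ofWord_injOn {u w : List Bool} (h : ofWord u = ofWord w) (hne : (ofWord u).perm ≠ 1) :
    u = w := by
  have hl : u.length = w.length := congrArg length h
  have h1 := ofWord_eq_mk (fun i => w.get (Fin.cast hl i)) w hl.symm (by simp)
  rw [h1] at h
  simp only [ofWord, mk.injEq, heq_eq_eq, true_and] at h
  have h2 := eq_of_sort_eq h hne
  refine List.ext_get hl fun i hi hi' => ?_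
  simpa using congrFun h2 ⟨i, hi⟩

theorem ofWord_perm_eq_one_iff {w : List Bool} : (ofWord w).perm = 1 ↔ Monotone w.get :=
  Tuple.sort_eq_refl_iff_monotone

theorem ofWord_perm_ne_one {w : List Bool} (h : [true, false].Sublist w) :
    (ofWord w).perm ≠ 1 := by
  rw [Ne, ofWord_perm_eq_one_iff]
  intro hm
  obtain ⟨g, hg⟩ := List.sublist_iff_exists_fin_orderEmbedding_get_eq.1 h
  have h1 : g ⟨0, by simp⟩ ≤ g ⟨1, by simp⟩ := g.monotone (by simp)
  have h2 := hm h1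
  rw [← hg, ← hg] at h2
  exact absurd h2 (by decide)

/-! ### From words to the Möbius function of permutations -/

/-- The increasing permutation of length two. -/
def oneTwo : FinPerm := ⟨2, 1⟩

theorem ofWord_singleton (a : Bool) : ofWord [a] = one :=
  congrArg (mk 1) (Subsingleton.elim _ _)

theorem ofWord_pair {a b : Bool} (h : a ≤ b) : ofWord [a, b] = oneTwo := by
  refine congrArg (mk 2) (Tuple.sort_eq_refl_iff_monotone.2 fun i j hij => ?_)
  change Fin 2 at i j
  fin_cases i <;> fin_cases j <;> simp_all

theorem one_le_ofWord {w : List Bool} (h : w ≠ []) : one ≤ ofWord w := by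
  obtain ⟨a, w, rfl⟩ := List.exists_cons_of_ne_nil h
  rw [← ofWord_singleton a]
  exact ofWord_le_ofWord (by simp)

theorem oneTwo_not_le_one : ¬ oneTwo ≤ one := fun h => by
  have : 2 ≤ 1 := length_le_of_le h
  omega

/-- The only decreasing pair of binary letters is true, false, and any letter after it forms a
weakly increasing pair with that false. -/
theorem oneTwo_le_ofWord_iff {w : List Bool} (h : 2 ≤ w.length) :
    oneTwo ≤ ofWord w ↔ w ≠ [true, false] := by
  constructor
  · rintro h1 rfl
    obtain ⟨u, hu, hu'⟩ := exists_sublist_of_le_ofWord h1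
    have hl : u.length = 2 := congrArg length hu'
    obtain rfl := hu.eq_of_length hl
    exact ofWord_perm_ne_one (w := [true, false]) (List.Sublist.refl _) (by rw [hu']; rfl)
  · intro hw
    have key : ∀ a b : Bool, a ≤ b → [a, b].Sublist w → oneTwo ≤ ofWord w := fun a b hab hs => by
      rw [← ofWord_pair hab]
      exact ofWord_le_ofWord hs
    match w, h, hw, key with
    | [a, b], _, hw, key =>
      refine key a b ?_ (List.Sublist.refl _)
      revert hw
      cases a <;> cases b <;> simp
    | a :: b :: c :: w, _, _, key =>
      by_cases hab : a ≤ b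
      · exact key a b hab (by simp)
      · refine key b c ?_ (by simp)
        revert hab
        cases a <;> cases b <;> simp

/-- The contribution of the increasing permutations to the Möbius function. -/
noncomputable def increasingPart (z : FinPerm) : ℤ :=
  (if z = one then 1 else 0) - if z = oneTwo then 1 else 0

open Classical in
/-- The contribution of the permutations with exactly one descent to the Möbius function. -/
noncomputable def descentPart (z : FinPerm) : ℤ :=
  if h : z.perm ≠ 1 ∧ ∃ w, ofWord w = z then normalSum none h.2.choose [true, false] else 0

/-- The chosen word is the only one when the permutation is not increasing; otherwise `w` has no
subword [true, false] and both sides vanish. -/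
theorem descentPart_ofWord (w : List Bool) :
    descentPart (ofWord w) = normalSum none w [true, false] := by
  unfold descentPart
  split_ifs with h
  · congr 1
    refine ofWord_injOn h.2.choose_spec ?_
    rw [h.2.choose_spec]
    exact h.1
  · by_contra h'
    exact h ⟨ofWord_perm_ne_one (sublist_of_normalSum_ne_zero (Ne.symm h')), w, rfl⟩

theorem sum_descentPart (w : List Bool) :
    ∑ z ∈ Finset.Icc one (ofWord w), descentPart z = if w = [true, false] then 1 else 0 := by
  have h1 := sum_normalSum w [true, false]
  simp only [List.length_cons, List.length_nil] at h1
  norm_num at h1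
  rw [← h1]
  symm
  -- Words with a nonzero summand contain true, false, and on these the encoding is injective.
  refine Finset.sum_bij_ne_zero (fun u _ _ => ofWord u) ?_ ?_ ?_ ?_
  · intro u hu hne
    rw [Finset.mem_Icc]
    refine ⟨one_le_ofWord ?_, ofWord_le_ofWord (mem_subwords.1 hu)⟩
    rintro rfl
    simp [normalSum] at hne
  · intro u _ hne v _ _ h
    exact ofWord_injOn h (ofWord_perm_ne_one (sublist_of_normalSum_ne_zero hne))
  · intro z hz hne
    obtain ⟨u, hu, rfl⟩ := exists_sublist_of_le_ofWord (Finset.mem_Icc.1 hz).2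
    rw [descentPart_ofWord] at hne
    exact ⟨u, mem_subwords.2 hu, hne, rfl⟩
  · intro u _ _
    rw [descentPart_ofWord]

theorem one_le_oneTwo : one ≤ oneTwo := by
  rw [← ofWord_pair (le_refl true)]
  exact one_le_ofWord (by simp)

theorem sum_increasingPart {w : List Bool} (h : w ≠ []) :
    ∑ z ∈ Finset.Icc one (ofWord w), increasingPart z =
      1 - if oneTwo ∈ Finset.Icc one (ofWord w) then 1 else 0 := by
  simp only [increasingPart, Finset.sum_sub_distrib, Finset.sum_ite_eq', Finset.mem_Icc,
    le_refl, one_le_ofWord h, and_self, if_true]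

/-- Both sides have the same sums over the intervals from `one`, and every element below `ofWord w`
again comes from a word, so strong induction on the length applies. -/
theorem mobius_ofWord_eq {w : List Bool} (h : w ≠ []) :
    mobius (ofWord w) = increasingPart (ofWord w) - descentPart (ofWord w) := by
  have hsum : ∀ w : List Bool, w ≠ [] →
      ∑ z ∈ Finset.Icc one (ofWord w), (increasingPart z - descentPart z) =
        if one = ofWord w then 1 else 0 := by
    intro w hw
    rw [Finset.sum_sub_distrib, sum_increasingPart hw, sum_descentPart]
    by_cases h2 : 2 ≤ w.length
    · have h3 : one ≠ ofWord w := fun h => by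
        have : 1 = w.length := congrArg length h
        omega
      simp only [Finset.mem_Icc, one_le_oneTwo, oneTwo_le_ofWord_iff h2, h3]
      by_cases h4 : w = [true, false] <;> simp [h4]
    · match w, hw, h2 with
      | [a], _, _ =>
      have h3 : oneTwo ≠ one := fun h => oneTwo_not_le_one h.le
      simp [ofWord_singleton, h3]
      | a :: b :: w, _, h2 => simp at h2
  induction hn : w.length using Nat.strong_induction_on generalizing w with
  | _ n ih =>
    subst hn
    have h1 := hsum w h
    have h2 := IncidenceAlgebra.sum_Icc_mu_right (𝕜 := ℤ) one (ofWord w)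
    rw [← h1, ← Finset.Ico_insert_right (one_le_ofWord h), Finset.sum_insert (by simp),
      Finset.sum_insert (by simp)] at h2
    have h3 : ∑ z ∈ Finset.Ico one (ofWord w), IncidenceAlgebra.mu ℤ one z =
        ∑ z ∈ Finset.Ico one (ofWord w), (increasingPart z - descentPart z) := by
      refine Finset.sum_congr rfl fun z hz => ?_
      rw [Finset.mem_Ico] at hz
      obtain ⟨u, hu, rfl⟩ := exists_sublist_of_le_ofWord hz.2.le
      refine ih u.length ?_ (w := u) ?_ rfl
      · refine lt_of_le_of_ne hu.length_le fun hl => ?_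
        rw [hu.eq_of_length hl] at hz
        exact lt_irrefl _ hz.2
      · rintro rfl
        have : 1 ≤ 0 := length_le_of_le hz.1
        omega
    rw [h3] at h2
    exact add_right_cancel h2

theorem mobius_ofWord {w : List Bool} (h : 2 < w.length) :
    mobius (ofWord w) = -normalSum none w [true, false] := by
  rw [mobius_ofWord_eq (by rintro rfl; simp at h), descentPart_ofWord, increasingPart,
    if_neg, if_neg]
  · simp
  · intro h'
    have : w.length = 2 := congrArg length h'
    omega
  · intro h'
    have : w.length = 1 := congrArg length h'
    omega

end FinPerm

/-! ### Counting normal embeddings of words of length at most two -/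

/-- The letter at position `k` of a word, counted from `0`, equals its predecessor; the predecessor
of the first letter is `p`. -/
def IsRepeat {α : Type*} : Option α → List α → ℕ → Prop
  | _, [], _ => False
  | p, b :: _, 0 => p = some b
  | _, b :: u, k + 1 => IsRepeat (some b) u k

theorem isRepeat_succ {α : Type*} (u : List α) (k : ℕ) :
    ∀ p : Option α, IsRepeat p u (k + 1) ↔ k + 1 < u.length ∧ u[k]? = u[k + 1]? := by
  induction u generalizing k with
  | nil => simp [IsRepeat]
  | cons b u ih =>
    intro p
    cases k with
    | zero => cases u <;> simp [IsRepeat]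
    | succ k => simp [IsRepeat, ih]

theorem not_isRepeat_none_zero {α : Type*} (u : List α) : ¬ IsRepeat none u 0 := by
  cases u <;> simp [IsRepeat]

section Count

open Classical

theorem normalSum_nil_eq (u : List Bool) : ∀ p : Option Bool,
    normalSum p u [] = (-1) ^ u.length * if ∀ k, ¬ IsRepeat p u k then 1 else 0 := by
  induction u with
  | nil => simp [normalSum, IsRepeat]
  | cons b u ih =>
    intro p
    -- Position 0 is split off; the remaining positions are those of `u` with predecessor `b`.
    rw [← Nat.and_forall_add_one]
    simp only [normalSum, ih, IsRepeat, List.length_cons, pow_succ]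
    by_cases h : p = some b
    · simp [h]
    · by_cases h' : ∀ k, ¬ IsRepeat (some b) u k <;> simp [h, h']

theorem normalSum_singleton_eq (y : Bool) (u : List Bool) : ∀ p : Option Bool,
    normalSum p u [y] = (-1) ^ u.length * ∑ q ∈ Finset.range u.length,
      if u[q]? = some y ∧ ∀ k, IsRepeat p u k → k = q then 1 else 0 := by
  induction u with
  | nil => simp [normalSum]
  | cons b u ih =>
    intro p
    rw [List.length_cons, Finset.sum_range_succ']
    simp only [← Nat.and_forall_add_one (p := fun k => IsRepeat p (b :: u) k → _)]
    simp only [normalSum, ih, List.tail_cons, normalSum_nil_eq, IsRepeat, pow_succ]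
    by_cases h : p = some b <;> by_cases h' : y = b <;>
      simp [h, h', eq_comm (a := b)] <;> (try split_ifs) <;> ring

theorem normalSum_pair_eq (y z : Bool) (u : List Bool) : ∀ p : Option Bool,
    normalSum p u [y, z] = (-1) ^ u.length * ∑ i ∈ Finset.range u.length,
      ∑ j ∈ Finset.range u.length,
        if i < j ∧ u[i]? = some y ∧ u[j]? = some z ∧ ∀ k, IsRepeat p u k → k = i ∨ k = j
          then 1 else 0 := by
  induction u with
  | nil => simp [normalSum]
  | cons b u ih =>
    intro p
    simp only [List.length_cons, Finset.sum_range_succ']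
    simp only [← Nat.and_forall_add_one (p := fun k => IsRepeat p (b :: u) k → _)]
    simp only [normalSum, ih, List.tail_cons, normalSum_singleton_eq, IsRepeat, pow_succ]
    by_cases h : p = some b <;> by_cases h' : y = b <;>
      (simp [h, h', eq_comm (a := b)]; try ring)

end Count

/-! ### Order of the letters on each side of the descent -/

/-- `L 1, …, L n` is a rearrangement of `1, …, n` with a descent at position `d` and no other if
`d < n`, and without descents if `d = n`. -/
structure IsOneDescent (L : ℕ → ℕ) (n d : ℕ) : Prop where
  mem : ∀ j, 1 ≤ j → j ≤ n → 1 ≤ L j ∧ L j ≤ n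
  inj : ∀ i j, 1 ≤ i → i ≤ n → 1 ≤ j → j ≤ n → L i = L j → i = j
  surj : ∀ v, 1 ≤ v → v ≤ n → ∃ j, 1 ≤ j ∧ j ≤ n ∧ L j = v
  one_le : 1 ≤ d
  le : d ≤ n
  step : ∀ j, 1 ≤ j → j < n → j ≠ d → L j < L (j + 1)
  drop : d < n → L (d + 1) < L d

namespace IsOneDescent

variable {L : ℕ → ℕ} {n d : ℕ} (h : IsOneDescent L n d)
include h

theorem lt_left {i j : ℕ} (hi : 1 ≤ i) (hij : i < j) (hj : j ≤ d) : L i < L j := by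
  induction j, hij using Nat.le_induction with
  | base => exact h.step i hi (by have := h.le; omega) (by omega)
  | succ j hij ih =>
    exact (ih (by omega)).trans (h.step j (by omega) (by have := h.le; omega) (by omega))

theorem lt_right {i j : ℕ} (hi : d < i) (hij : i < j) (hj : j ≤ n) : L i < L j := by
  induction j, hij using Nat.le_induction with
  | base => exact h.step i (by omega) (by omega) (by omega)
  | succ j hij ih => exact (ih (by omega)).trans (h.step j (by omega) (by omega) (by omega))

theorem of_inversion {a b : ℕ} (ha : 1 ≤ a) (hab : a < b) (hb : b ≤ n) (hL : L b < L a) :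
    a ≤ d ∧ d < b := by
  constructor
  · by_contra hc
    exact absurd (h.lt_right (by omega) hab hb) (by omega)
  · by_contra hc
    exact absurd (h.lt_left ha hab (by omega)) (by omega)

theorem lt_iff_left {i j : ℕ} (hi : 1 ≤ i) (hi' : i ≤ d) (hj : 1 ≤ j) (hj' : j ≤ d) :
    L i < L j ↔ i < j := by
  refine ⟨fun hl => ?_, fun hl => h.lt_left hi hl hj'⟩
  by_contra hc
  rcases (not_lt.1 hc).lt_or_eq with hc | rfl
  · exact absurd (h.lt_left hj hc hi') (by omega)
  · omega

theorem lt_iff_right {i j : ℕ} (hi : d < i) (hi' : i ≤ n) (hj : d < j) (hj' : j ≤ n) :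
    L i < L j ↔ i < j := by
  refine ⟨fun hl => ?_, fun hl => h.lt_right hi hl hj'⟩
  by_contra hc
  rcases (not_lt.1 hc).lt_or_eq with hc | rfl
  · exact absurd (h.lt_right hj hc hi') (by omega)
  · omega

theorem eq_succ_of_left {i j : ℕ} (hi : 1 ≤ i) (hi' : i ≤ d) (hj : 1 ≤ j) (hj' : j ≤ d)
    (hL : L j = L i + 1) : j = i + 1 := by
  have h1 := (h.lt_iff_left hi hi' hj hj').1 (by omega)
  by_contra hc
  have h2 := h.lt_left hi (Nat.lt_succ_self i) (by omega)
  have h3 := h.lt_left (i := i + 1) (j := j) (by omega) (by omega) hj'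
  simp only [Nat.succ_eq_add_one] at h2
  omega

theorem eq_succ_of_right {i j : ℕ} (hi : d < i) (hi' : i ≤ n) (hj : d < j) (hj' : j ≤ n)
    (hL : L j = L i + 1) : j = i + 1 := by
  have h1 := (h.lt_iff_right hi hi' hj hj').1 (by omega)
  by_contra hc
  have h2 := h.lt_right hi (Nat.lt_succ_self i) (by omega)
  have h3 := h.lt_right (i := i + 1) (j := j) (by omega) (by omega) hj'
  simp only [Nat.succ_eq_add_one] at h2
  omega

end IsOneDescent

/-! ### Adjacencies and inversions read off the word -/

namespace FinPerm

variable (π : FinPerm)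

theorem letter_succ {i : ℕ} (h : i < π.length) : π.letter (i + 1) = (π.perm ⟨i, h⟩ : ℕ) + 1 := by
  rw [letter, dif_pos ⟨by omega, by omega⟩]
  simp

theorem exists_isOneDescent (hn : 1 ≤ π.length) (hd : π.descents.card ≤ 1) :
    ∃ d, IsOneDescent π.letter π.length d := by
  have hmem : ∀ j, 1 ≤ j → j ≤ π.length → 1 ≤ π.letter j ∧ π.letter j ≤ π.length := by
    intro j h1 h2
    obtain ⟨j, rfl⟩ := Nat.exists_eq_add_of_le' h1
    rw [letter_succ π h2]
    have := (π.perm ⟨j, h2⟩).2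
    omega
  have hinj : ∀ i j, 1 ≤ i → i ≤ π.length → 1 ≤ j → j ≤ π.length →
      π.letter i = π.letter j → i = j := by
    intro i j h1 h2 h3 h4 he
    obtain ⟨i, rfl⟩ := Nat.exists_eq_add_of_le' h1
    obtain ⟨j, rfl⟩ := Nat.exists_eq_add_of_le' h3
    rw [letter_succ π h2, letter_succ π h4] at he
    simpa [Fin.val_inj] using he
  have hsurj : ∀ v, 1 ≤ v → v ≤ π.length → ∃ j, 1 ≤ j ∧ j ≤ π.length ∧ π.letter j = v := by
    intro v h1 h2
    obtain ⟨v, rfl⟩ := Nat.exists_eq_add_of_le' h1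
    refine ⟨π.perm.symm ⟨v, h2⟩ + 1, by omega, (π.perm.symm ⟨v, h2⟩).2, ?_⟩
    rw [letter_succ π (π.perm.symm ⟨v, h2⟩).2]
    simp
  have hstep : ∀ j, 1 ≤ j → j < π.length → j ∉ π.descents → π.letter j < π.letter (j + 1) := by
    intro j h1 h2 h3
    simp only [descents, Finset.mem_filter, Finset.mem_Ico, not_and, not_lt] at h3
    refine lt_of_le_of_ne (h3 ⟨h1, h2⟩) fun he => ?_
    have := hinj j (j + 1) h1 h2.le (by omega) h2 he
    omega
  rcases π.descents.eq_empty_or_nonempty with he | ⟨d, hd'⟩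
  · exact ⟨π.length, hmem, hinj, hsurj, hn, le_rfl,
      fun j h1 h2 _ => hstep j h1 h2 (by simp [he]), fun h => absurd h (lt_irrefl _)⟩
  · have hd'' := hd'
    simp only [descents, Finset.mem_filter, Finset.mem_Ico] at hd''
    exact ⟨d, hmem, hinj, hsurj, hd''.1.1, hd''.1.2.le,
      fun j h1 h2 h3 => hstep j h1 h2 fun h4 => h3 (Finset.card_le_one.1 hd j h4 d hd'),
      fun _ => hd''.2⟩

/-- The word whose letter at position `v` says whether the letter `v` of `π` occurs to the right of
position `d`. -/
def toWord (d : ℕ) : List Bool := List.ofFn fun v => decide (d ≤ (π.perm.symm v : ℕ))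

variable {π}

theorem length_toWord (d : ℕ) : (π.toWord d).length = π.length := by
  simp [toWord]

theorem toWord_getElem? (d : ℕ) {j : ℕ} (h : 1 ≤ j) (h' : j ≤ π.length) :
    (π.toWord d)[π.letter j - 1]? = some (decide (d < j)) := by
  obtain ⟨j, rfl⟩ := Nat.exists_eq_add_of_le' h
  rw [letter_succ π h']
  simp [toWord]

/-- The letters increase on each side of `d`, so `π` is the stable sorting permutation of its own
word. -/
theorem ofWord_toWord {d : ℕ} (h : IsOneDescent π.letter π.length d) :
    ofWord (π.toWord d) = π := by
  rw [ofWord_eq_mk (fun v => decide (d ≤ (π.perm.symm v : ℕ))) _ (length_toWord d)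
    fun i => List.get_ofFn _ i]
  obtain ⟨n, σ⟩ := π
  congr 1
  symm
  rw [Tuple.eq_sort_iff]
  constructor
  · intro i j hij
    simp only [Function.comp_apply, Equiv.symm_apply_apply]
    intro hd
    have hij' : (i : ℕ) ≤ j := hij
    simp only [decide_eq_true_eq] at hd ⊢
    omega
  · intro i j hij he
    simp only [Equiv.symm_apply_apply, decide_eq_decide] at he
    have hij' : (i : ℕ) < j := hij
    have hL : letter ⟨n, σ⟩ (i + 1) < letter ⟨n, σ⟩ (j + 1) := by
      by_cases hi : d ≤ i
      · exact h.lt_right (by omega) (by omega) j.2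
      · exact h.lt_left (by omega) (by omega) (by omega)
    rw [letter_succ ⟨n, σ⟩ i.2, letter_succ ⟨n, σ⟩ j.2] at hL
    exact Fin.lt_def.2 (Nat.lt_of_succ_lt_succ hL)

theorem mem_adjacencies {i : ℕ} : i ∈ π.adjacencies ↔
    (1 ≤ i ∧ i < π.length) ∧ π.letter (i + 1) = π.letter i + 1 := by
  simp [adjacencies]

/-- Two consecutive values on the same side of `d` stand at consecutive positions, because each side
increases. Position `k` of the word belongs to the letter `k + 1`. -/
theorem isRepeat_toWord_iff {d : ℕ} (h : IsOneDescent π.letter π.length d) {k : ℕ} :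
    IsRepeat none (π.toWord d) k ↔ ∃ i ∈ π.adjacencies, π.letter (i + 1) = k + 1 := by
  cases k with
  | zero =>
    refine iff_of_false (not_isRepeat_none_zero _) ?_
    rintro ⟨i, hi, hk⟩
    rw [mem_adjacencies] at hi
    have := h.mem i hi.1.1 hi.1.2.le
    omega
  | succ k =>
    rw [isRepeat_succ, length_toWord]
    constructor
    · rintro ⟨hk, he⟩
      obtain ⟨i, hi, hi', hik⟩ := h.surj (k + 1) (by omega) (by omega)
      obtain ⟨j, hj, hj', hjk⟩ := h.surj (k + 2) (by omega) (by omega)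
      have h1 := toWord_getElem? d hi hi'
      have h2 := toWord_getElem? d hj hj'
      rw [hik, Nat.add_sub_cancel] at h1
      rw [hjk, show k + 2 - 1 = k + 1 from rfl] at h2
      rw [h1, h2] at he
      simp only [Option.some.injEq, decide_eq_decide] at he
      have hij : j = i + 1 := by
        by_cases hid : d < i
        · exact h.eq_succ_of_right hid hi' (he.1 hid) hj' (by omega)
        · exact h.eq_succ_of_left hi (by omega) hj (by omega) (by omega)
      subst hij
      exact ⟨i, mem_adjacencies.2 ⟨⟨hi, hj'⟩, by omega⟩, hjk⟩
    · rintro ⟨i, hi, hk⟩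
      rw [mem_adjacencies] at hi
      have h1 := toWord_getElem? d hi.1.1 hi.1.2.le
      have h2 := toWord_getElem? d (j := i + 1) (by omega) hi.1.2
      have h3 := h.mem (i + 1) (by omega) hi.1.2
      have h4 : i ≠ d := by
        rintro rfl
        have := h.drop hi.1.2
        omega
      refine ⟨by omega, ?_⟩
      rw [show π.letter i - 1 = k by omega] at h1
      rw [hk, show k + 1 + 1 - 1 = k + 1 from rfl] at h2
      rw [h1, h2]
      simp only [Option.some.injEq, decide_eq_decide]
      omega

/-- The inversions of `π`, as pairs of positions, that contain the second position of every
adjacency. -/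
def normalInversions (π : FinPerm) : Finset (ℕ × ℕ) :=
  (Finset.Icc 1 π.length ×ˢ Finset.Icc 1 π.length).filter fun x =>
    x.1 < x.2 ∧ π.letter x.2 < π.letter x.1 ∧ ∀ i ∈ π.adjacencies, i + 1 = x.1 ∨ i + 1 = x.2

theorem mem_normalInversions {a b : ℕ} : (a, b) ∈ π.normalInversions ↔
    1 ≤ a ∧ a < b ∧ b ≤ π.length ∧ π.letter b < π.letter a ∧
      ∀ i ∈ π.adjacencies, i + 1 = a ∨ i + 1 = b := by
  simp only [normalInversions, Finset.mem_filter, Finset.mem_product, Finset.mem_Icc]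
  constructor
  · rintro ⟨⟨⟨h1, -⟩, -, h2⟩, h3, h4, h5⟩
    exact ⟨h1, h3, h2, h4, h5⟩
  · rintro ⟨h1, h3, h2, h4, h5⟩
    exact ⟨⟨⟨h1, by omega⟩, by omega, h2⟩, h3, h4, h5⟩

-- An inversion `(a, b)` satisfies `a ≤ d < b`. The word is indexed by letters, so the smaller
-- letter, at `b`, comes first and reads true; the one at `a` reads false.
open Classical in
theorem card_normalInversions {d : ℕ} (h : IsOneDescent π.letter π.length d) :
    π.normalInversions.card =
      ((Finset.range π.length ×ˢ Finset.range π.length).filter fun x =>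
        x.1 < x.2 ∧ (π.toWord d)[x.1]? = some true ∧ (π.toWord d)[x.2]? = some false ∧
          ∀ k, IsRepeat none (π.toWord d) k → k = x.1 ∨ k = x.2).card := by
  have hsub : ∀ {i j : ℕ}, 1 ≤ i → i ≤ π.length → 1 ≤ j → j ≤ π.length →
      π.letter i - 1 = π.letter j - 1 → i = j := fun {i j} h1 h2 h3 h4 h5 => by
    have := h.mem i h1 h2
    have := h.mem j h3 h4
    exact h.inj i j h1 h2 h3 h4 (by omega)
  refine Finset.card_bij (fun x _ => (π.letter x.2 - 1, π.letter x.1 - 1)) ?_ ?_ ?_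
  · rintro ⟨a, b⟩ hx
    obtain ⟨ha, hab, hb, hL, hadj⟩ := mem_normalInversions.1 hx
    have h1 := h.mem a ha (by omega)
    have h2 := h.mem b (by omega) hb
    have h3 := h.of_inversion ha hab hb hL
    simp only [Finset.mem_filter, Finset.mem_product, Finset.mem_range]
    rw [toWord_getElem? d ha (by omega), toWord_getElem? d (by omega) hb]
    refine ⟨⟨by omega, by omega⟩, by omega, by simpa using h3.2, by simpa using h3.1, ?_⟩
    intro k hk
    obtain ⟨i, hi, hik⟩ := (isRepeat_toWord_iff h).1 hk
    rcases hadj i hi with rfl | rfl <;> omega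
  · rintro ⟨a, b⟩ hx ⟨a', b'⟩ hx' he
    obtain ⟨ha, hab, hb, -, -⟩ := mem_normalInversions.1 hx
    obtain ⟨ha', hab', hb', -, -⟩ := mem_normalInversions.1 hx'
    simp only [Prod.mk.injEq] at he ⊢
    exact ⟨hsub ha (by omega) ha' (by omega) he.2, hsub (by omega) hb (by omega) hb' he.1⟩
  · rintro ⟨p, q⟩ hx
    simp only [Finset.mem_filter, Finset.mem_product, Finset.mem_range] at hx
    obtain ⟨⟨hp, hq⟩, hpq, hpt, hqf, hrep⟩ := hx
    obtain ⟨b, hb, hb', hbp⟩ := h.surj (p + 1) (by omega) (by omega)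
    obtain ⟨a, ha, ha', haq⟩ := h.surj (q + 1) (by omega) (by omega)
    have h1 := toWord_getElem? d hb hb'
    have h2 := toWord_getElem? d ha ha'
    rw [hbp, Nat.add_sub_cancel, hpt] at h1
    rw [haq, Nat.add_sub_cancel, hqf] at h2
    simp at h1 h2
    refine ⟨(a, b), mem_normalInversions.2 ⟨ha, by omega, hb', by omega, fun i hi => ?_⟩, ?_⟩
    · have hi' := (mem_adjacencies.1 hi).1
      have hm := h.mem (i + 1) (by omega) hi'.2
      have := hrep (π.letter (i + 1) - 1) ((isRepeat_toWord_iff h).2 ⟨i, hi, by omega⟩)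
      rcases this with h3 | h3
      · exact Or.inr (h.inj _ _ (by omega) hi'.2 hb hb' (by omega))
      · exact Or.inl (h.inj _ _ (by omega) hi'.2 ha ha' (by omega))
    · simp [haq, hbp]

theorem mobius_eq {d : ℕ} (h : IsOneDescent π.letter π.length d) (hn : 2 < π.length) :
    π.mobius = (-1) ^ (π.length + 1) * (π.normalInversions.card : ℤ) := by
  classical
  have h1 : mobius (ofWord (π.toWord d)) = _ := mobius_ofWord (by rwa [length_toWord])
  rw [ofWord_toWord h] at h1
  rw [h1, normalSum_pair_eq, length_toWord, card_normalInversions h, ← Finset.sum_product',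
    Finset.card_filter]
  push_cast
  ring

end FinPerm

/-! ### Inversion counts and letters forced by missing adjacencies -/

namespace IsOneDescent

variable {L : ℕ → ℕ} {n d : ℕ} (h : IsOneDescent L n d)
include h

theorem card_letter_lt {v : ℕ} (hv : 1 ≤ v) (hv' : v ≤ n) :
    ((Finset.Icc 1 n).filter fun j => L j < v).card + 1 = v := by
  have h1 : ((Finset.Icc 1 n).filter fun j => L j < v).card = (Finset.Ico 1 v).card := by
    refine Finset.card_bij (fun j _ => L j) ?_ ?_ ?_
    · intro j hj
      simp only [Finset.mem_filter, Finset.mem_Icc, Finset.mem_Ico] at hj ⊢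
      exact ⟨(h.mem j hj.1.1 hj.1.2).1, hj.2⟩
    · intro i hi j hj
      simp only [Finset.mem_filter, Finset.mem_Icc] at hi hj
      exact h.inj i j hi.1.1 hi.1.2 hj.1.1 hj.1.2
    · intro w hw
      rw [Finset.mem_Ico] at hw
      obtain ⟨j, hj, hj', rfl⟩ := h.surj w hw.1 (by omega)
      exact ⟨j, by simp [hj, hj', hw.2], rfl⟩
  rw [h1, Nat.card_Ico]
  omega

/-- Of the `L a - 1` smaller letters, exactly the `a - 1` letters before position `a` do not stand
to its right. -/
theorem card_inversions_left {a : ℕ} (ha : 1 ≤ a) (ha' : a ≤ d) :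
    ((Finset.Icc 1 n).filter fun b => a < b ∧ L b < L a).card + a = L a := by
  have h1 := h.le
  have h2 := h.mem a ha (by omega)
  have h3 := h.card_letter_lt h2.1 h2.2
  rw [← Finset.card_filter_add_card_filter_not (s := (Finset.Icc 1 n).filter fun j => L j < L a)
    (fun b => a < b)] at h3
  have h4 : ((Finset.Icc 1 n).filter fun j => L j < L a).filter (fun b => a < b) =
      (Finset.Icc 1 n).filter fun b => a < b ∧ L b < L a := by
    rw [Finset.filter_filter]
    exact Finset.filter_congr fun _ _ => and_comm
  have h5 : ((Finset.Icc 1 n).filter fun j => L j < L a).filter (fun b => ¬ a < b) =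
      Finset.Ico 1 a := by
    ext j
    simp only [Finset.mem_filter, Finset.mem_Icc, Finset.mem_Ico]
    constructor
    · rintro ⟨⟨⟨h6, -⟩, h7⟩, h8⟩
      refine ⟨h6, lt_of_le_of_ne (by omega) ?_⟩
      rintro rfl
      omega
    · rintro ⟨h6, h7⟩
      exact ⟨⟨⟨h6, by omega⟩, h.lt_left h6 h7 ha'⟩, by omega⟩
  rw [h4, h5, Nat.card_Ico] at h3
  omega

/-- All `L b - 1` smaller letters stand before position `b`, so the other letters before it are the
larger ones. -/
theorem card_inversions_right {b : ℕ} (hb : d < b) (hb' : b ≤ n) :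
    ((Finset.Icc 1 n).filter fun a => a < b ∧ L b < L a).card + L b = b := by
  have h1 := h.one_le
  have h2 := h.mem b (by omega) hb'
  have h3 := h.card_letter_lt h2.1 h2.2
  have h4 : (Finset.Ico 1 b).filter (fun j => L j < L b) =
      (Finset.Icc 1 n).filter fun j => L j < L b := by
    ext j
    simp only [Finset.mem_filter, Finset.mem_Icc, Finset.mem_Ico]
    refine ⟨fun h6 => ⟨⟨h6.1.1, by omega⟩, h6.2⟩, fun h6 => ⟨⟨h6.1.1, ?_⟩, h6.2⟩⟩
    by_cases hj : d < j
    · exact (h.lt_iff_right hj h6.1.2 hb hb').1 h6.2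
    · omega
  have h5 : (Finset.Ico 1 b).filter (fun j => ¬ L j < L b) =
      (Finset.Icc 1 n).filter fun a => a < b ∧ L b < L a := by
    ext j
    simp only [Finset.mem_filter, Finset.mem_Icc, Finset.mem_Ico, not_lt]
    constructor
    · rintro ⟨⟨h6, h7⟩, h8⟩
      refine ⟨⟨h6, by omega⟩, h7, lt_of_le_of_ne h8 fun he => ?_⟩
      have := h.inj b j (by omega) hb' h6 (by omega) he
      omega
    · rintro ⟨⟨h6, -⟩, h7, h8⟩
      exact ⟨⟨h6, h7⟩, h8.le⟩
  have h6 := Finset.card_filter_add_card_filter_not (s := Finset.Ico 1 b) (fun j => L j < L b)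
  rw [h4, h5, Nat.card_Ico] at h6
  omega

section NoAdjacencyRight

variable (hB : ∀ j, d < j → j < n → L (j + 1) ≠ L j + 1)
include hB

/-- If `v` and `v + 1` both stood on the right they would form an adjacency there. -/
theorem exists_left_of_consecutive {v : ℕ} (hv : 1 ≤ v) (hv' : v < n) :
    ∃ j, 1 ≤ j ∧ j ≤ d ∧ v ≤ L j ∧ L j ≤ v + 1 := by
  obtain ⟨i, hi, hi', hiv⟩ := h.surj v hv hv'.le
  obtain ⟨j, hj, hj', hjv⟩ := h.surj (v + 1) (by omega) hv'
  by_cases h1 : i ≤ d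
  · exact ⟨i, hi, h1, by omega, by omega⟩
  by_cases h2 : j ≤ d
  · exact ⟨j, hj, h2, by omega, by omega⟩
  obtain rfl := h.eq_succ_of_right (by omega) hi' (by omega) hj' (by omega : L j = L i + 1)
  exact absurd (by omega) (hB i (by omega) hj')

theorem first_left (hn : 2 ≤ n) : L 1 ≤ 2 := by
  obtain ⟨j, hj, hj', -, h1⟩ := h.exists_left_of_consecutive hB le_rfl hn
  rcases hj.eq_or_lt with rfl | hj
  · omega
  · have := h.lt_left le_rfl hj hj'
    omega

theorem last_left (hn : 2 ≤ n) : n ≤ L d + 1 := by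
  obtain ⟨j, hj, hj', h1, -⟩ := h.exists_left_of_consecutive hB (v := n - 1) (by omega) (by omega)
  rcases hj'.eq_or_lt with rfl | hj'
  · omega
  · have := h.lt_left hj hj' le_rfl
    omega

theorem gap_left {j : ℕ} (hj : 1 ≤ j) (hj' : j < d) : L (j + 1) ≤ L j + 2 := by
  by_contra hc
  have h1 := h.mem (j + 1) (by omega) (by have := h.le; omega)
  obtain ⟨i, hi, hi', h2, h3⟩ := h.exists_left_of_consecutive hB (v := L j + 1) (by omega)
    (by omega)
  have h4 := (h.lt_iff_left hj hj'.le hi hi').1 (by omega)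
  have h5 := (h.lt_iff_left hi hi' (by omega) hj').1 (by omega : L i < L (j + 1))
  omega

/-- Steps are at most 2 by `gap_left` and differ from 1 before `s`. The bound `s` lets the
progression stop at a single adjacency. -/
theorem letter_left {s : ℕ} (hs : s ≤ d) (hA : ∀ j, 1 ≤ j → j < s → L (j + 1) ≠ L j + 1) {j : ℕ}
    (hj : 1 ≤ j) (hjs : j ≤ s) : L j + 2 = L 1 + 2 * j := by
  induction j, hj using Nat.le_induction with
  | base => omega
  | succ j hj ih =>
    have h1 := h.gap_left hB hj (by omega)
    have h2 := h.lt_left hj (Nat.lt_succ_self j) (by omega)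
    have h3 := hA j hj hjs
    have h4 := ih (by omega)
    simp only [Nat.succ_eq_add_one] at h2
    omega

end NoAdjacencyRight

section NoAdjacencyLeft

variable (hA : ∀ j, 1 ≤ j → j < d → L (j + 1) ≠ L j + 1)
include hA

theorem exists_right_of_consecutive {v : ℕ} (hv : 1 ≤ v) (hv' : v < n) :
    ∃ j, d < j ∧ j ≤ n ∧ v ≤ L j ∧ L j ≤ v + 1 := by
  obtain ⟨i, hi, hi', hiv⟩ := h.surj v hv hv'.le
  obtain ⟨j, hj, hj', hjv⟩ := h.surj (v + 1) (by omega) hv'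
  by_cases h1 : d < i
  · exact ⟨i, h1, hi', by omega, by omega⟩
  by_cases h2 : d < j
  · exact ⟨j, h2, hj', by omega, by omega⟩
  obtain rfl := h.eq_succ_of_left hi (by omega) hj (by omega) (by omega : L j = L i + 1)
  exact absurd (by omega) (hA i hi (by omega))

theorem first_right (hn : 2 ≤ n) : L (d + 1) ≤ 2 := by
  obtain ⟨j, hj, hj', -, h1⟩ := h.exists_right_of_consecutive hA le_rfl hn
  rcases (Nat.succ_le_of_lt hj).eq_or_lt with rfl | hj
  · exact h1
  · have := h.lt_right (Nat.lt_succ_self d) hj hj'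
    simp only [Nat.succ_eq_add_one] at this
    omega

theorem last_right (hn : 2 ≤ n) : n ≤ L n + 1 := by
  obtain ⟨j, hj, hj', h1, -⟩ := h.exists_right_of_consecutive hA (v := n - 1) (by omega) (by omega)
  rcases hj'.eq_or_lt with rfl | hj'
  · omega
  · have := h.lt_right hj hj' le_rfl
    omega

theorem gap_right {j : ℕ} (hj : d < j) (hj' : j < n) : L (j + 1) ≤ L j + 2 := by
  by_contra hc
  have h1 := h.mem (j + 1) (by omega) (by omega)
  obtain ⟨i, hi, hi', h2, h3⟩ := h.exists_right_of_consecutive hA (v := L j + 1) (by omega)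
    (by omega)
  have h4 := (h.lt_iff_right hj hj'.le hi hi').1 (by omega)
  have h5 := (h.lt_iff_right hi hi' (by omega) hj').1 (by omega : L i < L (j + 1))
  omega

theorem letter_right {s : ℕ} (hs : d < s) (hB : ∀ j, s ≤ j → j < n → L (j + 1) ≠ L j + 1) {j : ℕ}
    (hj : s ≤ j) (hjs : j ≤ n) : L j + 2 * s = L s + 2 * j := by
  induction j, hj using Nat.le_induction with
  | base => omega
  | succ j hj ih =>
    have h1 := h.gap_right hA (by omega) hjs
    have h2 := h.lt_right (by omega) (Nat.lt_succ_self j) (by omega)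
    have h3 := hB j hj hjs
    have h4 := ih (by omega)
    simp only [Nat.succ_eq_add_one] at h2
    omega

end NoAdjacencyLeft

end IsOneDescent

theorem sum_Icc_eq_choose {f : ℕ → ℕ} {d : ℕ} (hf : ∀ a, 1 ≤ a → a ≤ d → f a + 1 = a) :
    ∑ a ∈ Finset.Icc 1 d, f a = d.choose 2 := by
  induction d with
  | zero => simp
  | succ d ih =>
    have h1 := hf (d + 1) (by omega) le_rfl
    have h2 : (d + 1).choose 2 = d.choose 1 + d.choose 2 := Nat.choose_succ_succ' d 1
    rw [Nat.choose_one_right] at h2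
    rw [Finset.sum_Icc_succ_top (by omega), ih fun a h1 h2 => hf a h1 (by omega)]
    omega

theorem sum_Icc_eq_choose_succ {f : ℕ → ℕ} {d : ℕ} (hf : ∀ a, 1 ≤ a → a ≤ d → f a = a) :
    ∑ a ∈ Finset.Icc 1 d, f a = (d + 1).choose 2 := by
  induction d with
  | zero => simp
  | succ d ih =>
    rw [Finset.sum_Icc_succ_top (by omega), ih fun a h1 h2 => hf a h1 (by omega),
      Nat.choose_succ_succ' (d + 1) 1, Nat.choose_one_right, hf (d + 1) (by omega) le_rfl, add_comm]

/-! ### Counting normal inversions by the number of adjacencies -/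

namespace FinPerm

variable {π : FinPerm}

theorem ext_letter {σ π : FinPerm} (hl : σ.length = π.length)
    (h : ∀ j, 1 ≤ j → j ≤ π.length → σ.letter j = π.letter j) : σ = π := by
  obtain ⟨n, σ⟩ := σ
  obtain ⟨m, π⟩ := π
  dsimp only at hl h
  subst hl
  congr 1
  ext i
  have := h (i + 1) (by omega) i.2
  rw [letter_succ ⟨n, σ⟩ i.2, letter_succ ⟨n, π⟩ i.2] at this
  exact Nat.succ_injective this

theorem letter_M {m j : ℕ} (hj : 1 ≤ j) (hj' : j ≤ 2 * m) :
    (M m).letter j = if j ≤ m then 2 * j else 2 * (j - m) - 1 := by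
  obtain ⟨j, rfl⟩ := Nat.exists_eq_add_of_le' hj
  rw [letter_succ (M m) hj']
  change (if j < m then 2 * j + 1 else 2 * (j - m)) + 1 = _
  split_ifs <;> omega

theorem letter_W {m j : ℕ} (hj : 1 ≤ j) (hj' : j ≤ 2 * m) :
    (W m).letter j = if j ≤ m then 2 * j - 1 else 2 * (j - m) := by
  obtain ⟨j, rfl⟩ := Nat.exists_eq_add_of_le' hj
  rw [letter_succ (W m) hj']
  change (if j < m then 2 * j else 2 * (j - m) + 1) + 1 = _
  split_ifs <;> omega

theorem normalInversions_eq_empty_of_lt {i k : ℕ} (hi : i ∈ π.adjacencies) (hk : k ∈ π.adjacencies)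
    (hik : i < k) (hL : π.letter i < π.letter k) : π.normalInversions = ∅ := by
  rw [Finset.eq_empty_iff_forall_notMem]
  rintro ⟨a, b⟩ hx
  obtain ⟨-, hab, -, hba, hadj⟩ := mem_normalInversions.1 hx
  have h1 := mem_adjacencies.1 hi
  have h2 := mem_adjacencies.1 hk
  -- The distinct positions `i + 1 < k + 1` both lie in `{a, b}`, so they are `a` and `b` in this
  -- order.
  obtain rfl : i + 1 = a := by
    rcases hadj i hi with h3 | h3 <;> rcases hadj k hk with h4 | h4 <;> omega
  obtain rfl : k + 1 = b := by
    rcases hadj k hk with h4 | h4 <;> omega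
  omega

theorem card_normalInversions_of_pair {i k : ℕ} (hadj : π.adjacencies = {i, k}) (hik : i < k)
    (hL : π.letter k < π.letter i) : π.normalInversions.card = 1 := by
  have h1 := mem_adjacencies.1 (by simp [hadj] : i ∈ π.adjacencies)
  have h2 := mem_adjacencies.1 (by simp [hadj] : k ∈ π.adjacencies)
  rw [Finset.card_eq_one]
  refine ⟨(i + 1, k + 1), ?_⟩
  ext ⟨a, b⟩
  rw [mem_normalInversions]
  simp only [hadj, Finset.mem_insert, Finset.mem_singleton, forall_eq_or_imp, forall_eq,
    Prod.mk.injEq]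
  constructor
  · rintro ⟨-, h3, -, -, h4, h5⟩
    omega
  · rintro ⟨rfl, rfl⟩
    refine ⟨by omega, by omega, by omega, by omega, Or.inl rfl, Or.inr rfl⟩

theorem letter_succ_ne (hadj : π.adjacencies = ∅) {j : ℕ} (hj : 1 ≤ j) (hj' : j < π.length) :
    π.letter (j + 1) ≠ π.letter j + 1 := by
  intro he
  have : j ∈ π.adjacencies := mem_adjacencies.2 ⟨⟨hj, hj'⟩, he⟩
  simp [hadj] at this

variable {d : ℕ} (h : IsOneDescent π.letter π.length d)
include h

/-- The adjacency forces `a = i + 1`. The letters rise by 2 up to position `i` and then by 1, so the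
letter at `a` is `π.letter 1 + 2 * i - 1`, and `a` is subtracted from it. -/
theorem card_normalInversions_of_left {i : ℕ} (hadj : π.adjacencies = {i}) (hid : i < d)
    (hn : 2 < π.length) : π.normalInversions.card + 2 = π.letter 1 + i ∧ π.letter 1 ≤ 2 := by
  have h1 := mem_adjacencies.1 (by simp [hadj] : i ∈ π.adjacencies)
  have hne : ∀ j, 1 ≤ j → j < π.length → j ≠ i → π.letter (j + 1) ≠ π.letter j + 1 := by
    intro j hj hj' hji he
    have : j ∈ π.adjacencies := mem_adjacencies.2 ⟨⟨hj, hj'⟩, he⟩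
    rw [hadj, Finset.mem_singleton] at this
    exact hji this
  have hB : ∀ j, d < j → j < π.length → π.letter (j + 1) ≠ π.letter j + 1 :=
    fun j hj hj' => hne j (by omega) hj' (by omega)
  have h2 := h.letter_left hB hid.le (fun j hj hj' => hne j hj (by omega) (by omega)) h1.1.1 le_rfl
  have h3 := h.card_inversions_left (a := i + 1) (by omega) hid
  have h4 : π.normalInversions = {i + 1} ×ˢ
      (Finset.Icc 1 π.length).filter fun b => i + 1 < b ∧ π.letter b < π.letter (i + 1) := by
    ext ⟨a, b⟩
    simp only [mem_normalInversions, hadj, Finset.mem_singleton, forall_eq, Finset.mem_product,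
      Finset.mem_filter, Finset.mem_Icc]
    constructor
    · rintro ⟨h5, h6, h7, h8, h9⟩
      have h10 := h.of_inversion h5 h6 h7 h8
      obtain rfl : a = i + 1 := by omega
      exact ⟨rfl, ⟨by omega, h7⟩, h6, h8⟩
    · rintro ⟨rfl, ⟨-, h7⟩, h6, h8⟩
      exact ⟨by omega, h6, h7, h8, Or.inl rfl⟩
  rw [h4, Finset.card_product, Finset.card_singleton, one_mul]
  refine ⟨?_, h.first_left hB (by omega)⟩
  omega

/-- The adjacency forces `b = i + 1`. From there to the end the letters rise by 2, so the last
letter determines the one at `b`. -/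
theorem card_normalInversions_of_right {i : ℕ} (hadj : π.adjacencies = {i}) (hid : d < i)
    (hn : 2 < π.length) : π.normalInversions.card + 1 + i = 2 * π.length - π.letter π.length ∧
      π.length ≤ π.letter π.length + 1 ∧ π.letter π.length ≤ π.length ∧ i < π.length := by
  have h1 := mem_adjacencies.1 (by simp [hadj] : i ∈ π.adjacencies)
  have hd := h.one_le
  have hne : ∀ j, 1 ≤ j → j < π.length → j ≠ i → π.letter (j + 1) ≠ π.letter j + 1 := by
    intro j hj hj' hji he
    have : j ∈ π.adjacencies := mem_adjacencies.2 ⟨⟨hj, hj'⟩, he⟩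
    rw [hadj, Finset.mem_singleton] at this
    exact hji this
  have hA : ∀ j, 1 ≤ j → j < d → π.letter (j + 1) ≠ π.letter j + 1 :=
    fun j hj hj' => hne j (by omega) (by omega) (by omega)
  have h2 := h.letter_right hA (s := i + 1) (by omega)
    (fun j hj hj' => hne j (by omega) (by omega) (by omega)) h1.1.2 le_rfl
  have h3 := h.card_inversions_right (b := i + 1) (by omega) h1.1.2
  have h4 : π.normalInversions = ((Finset.Icc 1 π.length).filter fun a =>
      a < i + 1 ∧ π.letter (i + 1) < π.letter a) ×ˢ {i + 1} := by
    ext ⟨a, b⟩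
    simp only [mem_normalInversions, hadj, Finset.mem_singleton, forall_eq, Finset.mem_product,
      Finset.mem_filter, Finset.mem_Icc]
    constructor
    · rintro ⟨h5, h6, h7, h8, h9⟩
      have h10 := h.of_inversion h5 h6 h7 h8
      obtain rfl : b = i + 1 := by omega
      exact ⟨⟨⟨h5, by omega⟩, h6, h8⟩, rfl⟩
    · rintro ⟨⟨⟨h5, -⟩, h6, h8⟩, rfl⟩
      exact ⟨h5, h6, h1.1.2, h8, Or.inr rfl⟩
  have h5 := h.last_right hA (by omega)
  have h6 := h.mem π.length (by omega) le_rfl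
  rw [h4, Finset.card_product, Finset.card_singleton, mul_one]
  omega

/-! ### Permutations without adjacencies -/

section NoAdjacencies

variable (hadj : π.adjacencies = ∅) (hn : 2 < π.length)
include hadj

theorem card_normalInversions_eq_sum : π.normalInversions.card = ∑ a ∈ Finset.Icc 1 d,
    ((Finset.Icc 1 π.length).filter fun b => a < b ∧ π.letter b < π.letter a).card := by
  rw [Finset.card_eq_sum_card_fiberwise (f := Prod.fst) (t := Finset.Icc 1 d)]
  · refine Finset.sum_congr rfl fun a ha => ?_
    trans (({a} : Finset ℕ) ×ˢ
      (Finset.Icc 1 π.length).filter fun b => a < b ∧ π.letter b < π.letter a).card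
    swap
    · rw [Finset.card_product, Finset.card_singleton, one_mul]
    congr 1
    ext ⟨a', b⟩
    rw [Finset.mem_Icc] at ha
    simp only [Finset.mem_filter, mem_normalInversions, hadj, Finset.notMem_empty,
      Finset.mem_product, Finset.mem_singleton, Finset.mem_Icc]
    constructor
    · rintro ⟨⟨h1, h2, h3, h4, -⟩, rfl⟩
      exact ⟨rfl, ⟨by omega, h3⟩, h2, h4⟩
    · rintro ⟨rfl, ⟨h1, h2⟩, h3, h4⟩
      exact ⟨⟨ha.1, h3, h2, h4, by simp⟩, rfl⟩
  · rintro ⟨a, b⟩ hx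
    obtain ⟨h1, h2, h3, h4, -⟩ := mem_normalInversions.1 hx
    have := h.of_inversion h1 h2 h3 h4
    simp only [Finset.coe_Icc, Set.mem_Icc]
    exact ⟨h1, this.1⟩

include hn

theorem letter_of_adjacencies_eq_empty :
    (π.letter 1 = 1 ∨ π.letter 1 = 2) ∧ d < π.length ∧
    (∀ j, 1 ≤ j → j ≤ d → π.letter j + 2 = π.letter 1 + 2 * j) ∧
    (∀ j, d < j → j ≤ π.length → π.letter j + 2 * d + π.letter 1 = 2 * j + 1) ∧
    (π.length + 1 = π.letter 1 + 2 * d ∨ π.length + 2 = π.letter 1 + 2 * d) := by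
  have hd := h.one_le
  have hd' := h.le
  have hA : ∀ j, 1 ≤ j → j < d → π.letter (j + 1) ≠ π.letter j + 1 :=
    fun j hj hj' => letter_succ_ne hadj hj (by omega)
  have hB : ∀ j, d < j → j < π.length → π.letter (j + 1) ≠ π.letter j + 1 :=
    fun j hj hj' => letter_succ_ne hadj (by omega) hj'
  have h1 := h.first_left hB (by omega)
  have h2 := h.mem 1 le_rfl (by omega)
  have h3 : ∀ j, 1 ≤ j → j ≤ d → π.letter j + 2 = π.letter 1 + 2 * j :=
    fun j hj hj' => h.letter_left hB le_rfl hA hj hj'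
  have h4 := h3 d hd le_rfl
  have h5 := h.last_left hB (by omega)
  have h6 := h.mem d hd hd'
  have h7 : d < π.length := by omega
  have h8 := h.first_right hA (by omega)
  have h9 := h.mem (d + 1) (by omega) h7
  -- Both runs begin with a letter at most 2, so their first letters are 1 and 2 in some order and
  -- add up to 3.
  have h10 : π.letter 1 ≠ π.letter (d + 1) := fun he => by
    have := h.inj 1 (d + 1) le_rfl (by omega) (by omega) h7 he
    omega
  refine ⟨by omega, h7, h3, fun j hj hj' => ?_, by omega⟩
  have h11 := h.letter_right hA (Nat.lt_succ_self d) (fun j hj hj' => hB j hj hj') hj hj'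
  simp only [Nat.succ_eq_add_one] at h11
  omega

theorem card_normalInversions_of_letter_one_eq_one (h1 : π.letter 1 = 1) :
    π.normalInversions.card = d.choose 2 := by
  rw [card_normalInversions_eq_sum h hadj]
  refine sum_Icc_eq_choose fun a ha ha' => ?_
  have h2 := h.card_inversions_left ha ha'
  have h3 := (letter_of_adjacencies_eq_empty h hadj hn).2.2.1 a ha ha'
  omega

theorem card_normalInversions_of_letter_one_eq_two (h1 : π.letter 1 = 2) :
    π.normalInversions.card = (d + 1).choose 2 := by
  rw [card_normalInversions_eq_sum h hadj]
  refine sum_Icc_eq_choose_succ fun a ha ha' => ?_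
  have h2 := h.card_inversions_left ha ha'
  have h3 := (letter_of_adjacencies_eq_empty h hadj hn).2.2.1 a ha ha'
  omega

theorem eq_W (he : Even π.length) (h1 : π.letter 1 = 1) :
    π = W (π.length / 2) ∧ π.length / 2 = d := by
  obtain ⟨-, h2, h3, h4, h5⟩ := letter_of_adjacencies_eq_empty h hadj hn
  have h6 := Nat.even_iff.1 he
  have hd : π.length / 2 = d := by omega
  refine ⟨?_, hd⟩
  rw [hd]
  refine ext_letter (by simp only [W]; omega) fun j hj hj' => ?_
  simp only [W] at hj'
  rw [letter_W hj hj']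
  split_ifs with hjd
  · have := h3 j hj hjd
    omega
  · have := h4 j (by omega) (by omega)
    omega

theorem eq_M (he : Even π.length) (h1 : π.letter 1 = 2) :
    π = M (π.length / 2) ∧ π.length / 2 = d := by
  obtain ⟨-, h2, h3, h4, h5⟩ := letter_of_adjacencies_eq_empty h hadj hn
  have h6 := Nat.even_iff.1 he
  have hd : π.length / 2 = d := by omega
  refine ⟨?_, hd⟩
  rw [hd]
  refine ext_letter (by simp only [M]; omega) fun j hj hj' => ?_
  simp only [M] at hj'
  rw [letter_M hj hj']
  split_ifs with hjd
  · have := h3 j hj hjd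
    omega
  · have := h4 j (by omega) (by omega)
    omega

theorem card_normalInversions_of_odd (ho : Odd π.length) :
    π.normalInversions.card = ((π.length + 1) / 2).choose 2 := by
  obtain ⟨h1, -, -, -, h5⟩ := letter_of_adjacencies_eq_empty h hadj hn
  have h6 := Nat.odd_iff.1 ho
  rcases h1 with h1 | h1
  · rw [card_normalInversions_of_letter_one_eq_one h hadj hn h1]
    congr 1
    omega
  · rw [card_normalInversions_of_letter_one_eq_two h hadj hn h1]
    congr 1
    omega

end NoAdjacencies


end FinPerm

/-! ### The theorem -/

theorem theorem1 (π : FinPerm) (n : ℕ) (hlen : π.length = n) (hn : 2 < n)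
    (hdes : π.descents.card ≤ 1) :
    -- 1. `π` begins with `12` or ends in `(n-1)n`
    ((π.letter 1 = 1 ∧ π.letter 2 = 2) ∨ (π.letter (n - 1) = n - 1 ∧ π.letter n = n) →
      π.mobius = 0) ∧
    -- 2. `π` has a triple adjacency
    ((∃ i, i ∈ π.adjacencies ∧ i + 1 ∈ π.adjacencies) → π.mobius = 0) ∧
    -- 3. `π` has more than two adjacencies
    (2 < π.adjacencies.card → π.mobius = 0) ∧
    -- 4. `π` has exactly two adjacencies, at positions `i < k`
    (∀ i k : ℕ, i < k → π.adjacencies = {i, k} →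
      (π.letter k < π.letter i → π.mobius = 1 ∨ π.mobius = -1) ∧
      (π.letter i < π.letter k → π.mobius = 0)) ∧
    -- 5. `π` has exactly one adjacency, at position `i`, and its descent is at position `d`
    (∀ i d : ℕ, π.adjacencies = {i} → π.descents = {d} →
      (i < d → π.letter 1 ≠ 1 → π.mobius = (i : ℤ) ∨ π.mobius = -(i : ℤ)) ∧
      (i < d → π.letter 1 = 1 → π.mobius = (i : ℤ) - 1 ∨ π.mobius = -((i : ℤ) - 1)) ∧
      (d < i → π.letter n ≠ n → π.mobius = (n : ℤ) - i ∨ π.mobius = -((n : ℤ) - i)) ∧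
      (d < i → π.letter n = n → π.mobius = (n : ℤ) - i - 1 ∨ π.mobius = -((n : ℤ) - i - 1))) ∧
    -- 6. `π` has no adjacencies
    (π.adjacencies = ∅ →
      (Even n → π.letter 1 = 1 ∨ π.letter 1 = 2) ∧
      (Even n → π.letter 1 = 1 → π = FinPerm.W (n / 2) ∧ π.mobius = -((n / 2).choose 2 : ℤ)) ∧
      (Even n → π.letter 1 = 2 → π = FinPerm.M (n / 2) ∧ π.mobius = -((n / 2 + 1).choose 2 : ℤ)) ∧
      (Odd n → π.mobius = (((n + 1) / 2).choose 2 : ℤ))) ∧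
    -- 7. the sign
    (π.mobius ≠ 0 → (0 < π.mobius ↔ Odd n)) := by
  subst hlen
  obtain ⟨d, h⟩ := π.exists_isOneDescent (by omega) hdes
  have hmob := FinPerm.mobius_eq h hn
  have hzero : π.normalInversions = ∅ → π.mobius = 0 := fun h0 => by simp [hmob, h0]
  have hsign : ∀ c : ℕ, π.normalInversions.card = c → π.mobius = c ∨ π.mobius = -(c : ℤ) := by
    rintro c rfl
    rw [hmob]
    rcases neg_one_pow_eq_or ℤ (π.length + 1) with h1 | h1 <;> simp [h1]
  have hdesc : ∀ e, π.descents = {e} → e = d := by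
    intro e he
    have h1 : e ∈ π.descents := by simp [he]
    simp only [FinPerm.descents, Finset.mem_filter, Finset.mem_Ico] at h1
    by_contra hed
    exact absurd (h.step e h1.1.1 h1.1.2 hed) (not_lt.2 h1.2.le)
  refine ⟨?_, ?_, ?_, ?_, ?_, ?_, ?_⟩
  · intro hc
    refine hzero (Finset.eq_empty_iff_forall_notMem.2 ?_)
    rintro ⟨a, b⟩ hx
    obtain ⟨ha, hab, hb, hba, hadj⟩ := FinPerm.mem_normalInversions.1 hx
    have h1 := h.mem a ha (by omega)
    have h2 := h.mem b (by omega) hb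
    rcases hc with ⟨hc1, hc2⟩ | ⟨hc1, hc2⟩
    · have h3 := hadj 1 (FinPerm.mem_adjacencies.2 ⟨⟨le_rfl, by omega⟩, by rw [hc1]; exact hc2⟩)
      -- Position 2 must belong to the inversion, but the letters 1 and 2 at the front leave no
      -- smaller letter to its right and no larger one to its left.
      have h4 : a = 2 ∨ (a = 1 ∧ b = 2) := by omega
      rcases h4 with rfl | ⟨rfl, rfl⟩
      · have := h.inj b 1 (by omega) hb le_rfl (by omega) (by omega)
        omega
      · omega
    · have h3 := hadj (π.length - 1) (FinPerm.mem_adjacencies.2 ⟨⟨by omega, by omega⟩, by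
        rw [Nat.sub_add_cancel (by omega)]
        omega⟩)
      -- The last position must belong to the inversion, yet no letter exceeds the final letter `n`.
      obtain rfl : b = π.length := by omega
      omega
  · rintro ⟨i, hi, hi'⟩
    refine hzero (FinPerm.normalInversions_eq_empty_of_lt hi hi' (by omega) ?_)
    have := (FinPerm.mem_adjacencies.1 hi).2
    omega
  · intro hc
    refine hzero (Finset.eq_empty_iff_forall_notMem.2 ?_)
    rintro ⟨a, b⟩ hx
    obtain ⟨-, -, -, -, hadj⟩ := FinPerm.mem_normalInversions.1 hx
    have h1 : π.adjacencies ⊆ {a - 1, b - 1} := fun i hi => by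
      have := hadj i hi
      simp only [Finset.mem_insert, Finset.mem_singleton]
      omega
    have h2 := (Finset.card_le_card h1).trans Finset.card_le_two
    omega
  · intro i k hik hadj
    refine ⟨fun hL => ?_, fun hL => ?_⟩
    · simpa using hsign 1 (FinPerm.card_normalInversions_of_pair hadj hik hL)
    · exact hzero (FinPerm.normalInversions_eq_empty_of_lt (by simp [hadj]) (by simp [hadj]) hik hL)
  · intro i e hadj he
    obtain rfl := hdesc e he
    have h1 := h.mem 1 le_rfl (by omega)
    refine ⟨fun hi hL => ?_, fun hi hL => ?_, fun hi hL => ?_, fun hi hL => ?_⟩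
    · obtain ⟨h2, h3⟩ := FinPerm.card_normalInversions_of_left h hadj hi hn
      exact hsign i (by omega)
    · obtain ⟨h2, h3⟩ := FinPerm.card_normalInversions_of_left h hadj hi hn
      have h4 : (π.normalInversions.card : ℤ) = i - 1 := by omega
      rw [← h4]
      exact hsign _ rfl
    · obtain ⟨h2, h3, h4, h5⟩ := FinPerm.card_normalInversions_of_right h hadj hi hn
      have h6 : (π.normalInversions.card : ℤ) = π.length - i := by omega
      rw [← h6]
      exact hsign _ rfl
    · obtain ⟨h2, h3, h4, h5⟩ := FinPerm.card_normalInversions_of_right h hadj hi hn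
      have h6 : (π.normalInversions.card : ℤ) = π.length - i - 1 := by omega
      rw [← h6]
      exact hsign _ rfl
  · intro hadj
    refine ⟨fun _ => (FinPerm.letter_of_adjacencies_eq_empty h hadj hn).1, fun he h1 => ?_,
      fun he h1 => ?_, fun ho => ?_⟩
    · obtain ⟨hW, hd⟩ := FinPerm.eq_W h hadj hn he h1
      refine ⟨hW, ?_⟩
      rw [hmob, FinPerm.card_normalInversions_of_letter_one_eq_one h hadj hn h1, hd,
        he.add_one.neg_one_pow, neg_one_mul]
    · obtain ⟨hM, hd⟩ := FinPerm.eq_M h hadj hn he h1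
      refine ⟨hM, ?_⟩
      rw [hmob, FinPerm.card_normalInversions_of_letter_one_eq_two h hadj hn h1, hd,
        he.add_one.neg_one_pow, neg_one_mul]
    · rw [hmob, FinPerm.card_normalInversions_of_odd h hadj hn ho, ho.add_one.neg_one_pow, one_mul]
  · intro hne
    rw [hmob] at hne ⊢
    rcases Nat.even_or_odd π.length with he | ho
    · rw [he.add_one.neg_one_pow]
      refine iff_of_false ?_ (Nat.not_odd_iff_even.2 he)
      omega
    · rw [ho.add_one.neg_one_pow, one_mul] at hne ⊢
      exact iff_of_true (by omega) ho
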